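/- Let $a$ be a real number with $0<a<2$, $a\neq 1$, and let $N\ge 2$ be an integer. Write $\csc x=1/\sin x$, $\mathscr F_{m}(\alpha)=\frac{d^{m}\csc\alpha}{d\alpha^{m}}$, $\delta_a=0$ if $0<a<1$ and $\delta_a=1$ if $1<a<2$; let $H_n=\sum_{k=1}^n \frac1k$, let $B_m$ be the Bernoulli numbers ($B_2=\frac16$, $B_4=-\frac1{30},\dots$) and let $\gamma$ be Euler's constant. Then, as $n\to\infty$ through all positive integers if $0<a<1$, and through the positive integers $n$ for which $n/a$ is not an integer if $1<a<2$, with constants in the $O$-terms that may depend on $a$ and $N$, both of the following expansions hold. (The term with the factor $\delta_a$ is absent when $0<a<1$.) (a) (Via the harmonic number.) $$ \begin{aligned} \sum_{l=1}^{n-1}\csc\frac{a\pi l}{n} ={}&\frac{n\,\delta_a}{a}\cot\frac{\pi n}{a}+\frac{nH_n}{a\pi}+\frac{n}{a\pi}\ln\left|\tan\frac{\pi a}{2}\right|+\frac{n}{a\pi}\ln\frac{2}{\pi a}-\frac{1}{2\pi a}-\frac{\csc (a\pi)}{2}\\ &+\frac{n}{a\pi}\left[\sum_{r=1}^{N-1}\frac{(a\pi)^{2r}B_{2r}}{n^{2r}(2r)!}\left\{\mathscr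 F_{2r-1}(a\pi)-\frac{(2^{2r}-2)(-1)^{r+1}B_{2r}}{2r}\right\}+\frac12\sum_{r=1}^{N-1}\frac{B_{2r}}{r\,n^{2r}}\right]+O\big(n^{1-2N}\big). \end{aligned} $$ (b) (Via the logarithm.) $$ \begin{aligned} \sum_{l=1}^{n-1}\csc\frac{a\pi l}{n} ={}&\frac{n\,\delta_a}{a}\cot\frac{\pi n}{a}+\frac{n}{a\pi}\left(\ln\frac{2n}{\pi a}+\gamma+\ln\left|\tan\frac{\pi a}{2}\right|\right)-\frac{\csc (a\pi)}{2}\\ &+\sum_{r=1}^{N-1}\frac{(a\pi)^{2r-1}B_{2r}}{n^{2r-1}(2r)!}\left\{\mathscr F_{2r-1}(a\pi)-\frac{(2^{2r}-2)(-1)^{r+1}B_{2r}}{2r}\right\}+O\big(n^{1-2N}\big). \end{aligned} $$ -/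

import Mathlib

open Filter Asymptotics
open scoped Topology

namespace CosecantSum

/-- The cosecant of a real number. -/
noncomputable def csc (x : ℝ) : ℝ := 1 / Real.sin x

/-- The finite sum of cosecants `S_n(φ, a) = ∑_{l=1}^{n-1} csc (φ + a π l / n)`. -/
noncomputable def S (n : ℕ) (φ a : ℝ) : ℝ :=
  ∑ l ∈ Finset.Ico 1 n, csc (φ + a * Real.pi * l / n)

/-- The `m`-th derivative of the cosecant at `α`. -/
noncomputable def F (m : ℕ) (α : ℝ) : ℝ := iteratedDeriv m csc α

/-- `δ_a`, equal to `0` for `a < 1` and to `1` for `a > 1` (only used for `a ≠ 1`). -/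
noncomputable def delta (a : ℝ) : ℝ := if a < 1 then 0 else 1

/-- The bracket `F_{2r-1}(a π) - (2^(2r) - 2) (-1)^(r+1) B_{2r} / (2r)`, used for `r ≥ 1`. -/
noncomputable def bracket (a : ℝ) (r : ℕ) : ℝ :=
  F (2 * r - 1) (a * Real.pi)
    - ((2 : ℝ) ^ (2 * r) - 2) * (-1) ^ (r + 1) * (bernoulli (2 * r) : ℝ) / (2 * r)

/-- The expansion of `S_n(0, a)` through the harmonic number `H_n`, truncated at order `N`. -/
noncomputable def harmonicExpansion (a : ℝ) (N n : ℕ) : ℝ :=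
  n * delta a / a * Real.cot (Real.pi * n / a)
    + n * (harmonic n : ℝ) / (a * Real.pi)
    + n / (a * Real.pi) * Real.log |Real.tan (Real.pi * a / 2)|
    + n / (a * Real.pi) * Real.log (2 / (Real.pi * a))
    - 1 / (2 * Real.pi * a)
    - csc (a * Real.pi) / 2
    + n / (a * Real.pi) *
      ((∑ r ∈ Finset.Icc 1 (N - 1),
          (a * Real.pi) ^ (2 * r) * (bernoulli (2 * r) : ℝ)
            / ((n : ℝ) ^ (2 * r) * ((2 * r).factorial : ℝ)) * bracket a r)
        + 1 / 2 * ∑ r ∈ Finset.Icc 1 (N - 1), (bernoulli (2 * r) : ℝ) / (r * (n : ℝ) ^ (2 * r)))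

/-- The expansion of `S_n(0, a)` through the logarithm, truncated at order `N`. -/
noncomputable def logExpansion (a : ℝ) (N n : ℕ) : ℝ :=
  n * delta a / a * Real.cot (Real.pi * n / a)
    + n / (a * Real.pi) *
      (Real.log (2 * n / (Real.pi * a)) + Real.eulerMascheroniConstant
        + Real.log |Real.tan (Real.pi * a / 2)|)
    - csc (a * Real.pi) / 2
    + ∑ r ∈ Finset.Icc 1 (N - 1),
        (a * Real.pi) ^ (2 * r - 1) * (bernoulli (2 * r) : ℝ)
          / ((n : ℝ) ^ (2 * r - 1) * ((2 * r).factorial : ℝ)) * bracket a r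

end CosecantSum

/-! Subtract from the cosecant its pole `1/x` at `0` and, when `a > 1`, its pole `-1/(x - π)` at
`π`. Since `a < 2`, the remainder `regularPart (delta a)` is analytic on `[0, aπ]`. Sampling at
`aπl/n` splits the sum exactly into three pieces (`S_eq`). The pole at `0` gives `n/(aπ) * H_{n-1}`.
The pole at `π` gives a finite sum of `1/(l - n/a)`. That sum is a difference of digamma values at
`n - n/a` and `n/a` plus a cotangent, by the partial fractions of `cot` (`poleSum_bound`). The
analytic remainder is handled by Euler–Maclaurin (`euler_maclaurin_samples`); its integral is
elementary and produces `log |tan (πa/2)|` (`integral_regularPart`), and its odd derivatives at `0`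
are Bernoulli numbers (`iteratedDeriv_csc_sub_inv`). The digamma and harmonic expansions
(`shiftedHarmonic_bound`) are themselves Euler–Maclaurin for `1/(t + y)`. Their terms cancel exactly
the polar parts of the endpoint derivatives of the remainder, leaving the derivatives of `csc`
itself at `aπ` (`logExpansion_eq`). Each of the three approximations has error `O(n^(1-2N))`. -/

namespace CosecantSum

open MeasureTheory intervalIntegral

/-! ### Euler–Maclaurin summation -/

/-- Integration by parts against a normalised Bernoulli polynomial. -/
theorem integral_bernoulliFun_mul (k : ℕ) {u v : ℝ → ℝ}
    (hu : ∀ t ∈ Set.Icc (0 : ℝ) 1, HasDerivAt u (v t) t) (hv : ContinuousOn v (Set.Icc 0 1)) :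
    ∫ t in (0 : ℝ)..1, bernoulliFun k t / k.factorial * u t =
      bernoulliFun (k + 1) 1 / (k + 1).factorial * u 1
        - bernoulliFun (k + 1) 0 / (k + 1).factorial * u 0
        - ∫ t in (0 : ℝ)..1, bernoulliFun (k + 1) t / (k + 1).factorial * v t := by
  have hb : ∀ t : ℝ, HasDerivAt (fun t => bernoulliFun (k + 1) t / (k + 1).factorial)
      (bernoulliFun k t / k.factorial) t := by
    intro t
    convert! (hasDerivAt_bernoulliFun (k + 1) t).div_const ((k + 1).factorial : ℝ) using 1
    rw [Nat.factorial_succ]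
    have : ((k : ℝ) + 1) ≠ 0 := by positivity
    have : (k.factorial : ℝ) ≠ 0 := by positivity
    rw [Nat.add_sub_cancel]
    push_cast
    field_simp
  have h := integral_mul_deriv_eq_deriv_mul (a := (0 : ℝ)) (b := 1) (u := u) (u' := v)
    (v := fun t => bernoulliFun (k + 1) t / (k + 1).factorial)
    (v' := fun t => bernoulliFun k t / k.factorial)
    (fun t ht => hu t (by simpa using ht)) (fun t _ => hb t)
    (by
      apply ContinuousOn.intervalIntegrable
      simpa using hv)
    (Continuous.intervalIntegrable (by fun_prop) _ _)
  simp only [mul_comm (u _), mul_comm (v _)] at h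
  rw [h]

/-- One cell of the Euler–Maclaurin formula. -/
theorem trapezoid_eq (f : ℕ → ℝ → ℝ)
    (hf : ∀ k, ∀ t ∈ Set.Icc (0 : ℝ) 1, HasDerivAt (f k) (f (k + 1) t) t) (m : ℕ) :
    (f 0 0 + f 0 1) / 2 = (∫ t in (0 : ℝ)..1, f 0 t)
      + ∑ r ∈ Finset.Icc 1 (m + 1), (bernoulli (2 * r) : ℝ) / (2 * r).factorial *
          (f (2 * r - 1) 1 - f (2 * r - 1) 0)
      - ∫ t in (0 : ℝ)..1,
          bernoulliFun (2 * (m + 1)) t / (2 * (m + 1)).factorial * f (2 * (m + 1)) t := by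
  have hc : ∀ k, ContinuousOn (f k) (Set.Icc 0 1) := fun k t ht =>
    (hf k t ht).continuousAt.continuousWithinAt
  induction m with
  | zero =>
    have h0 := integral_bernoulliFun_mul 0 (hf 0) (hc 1)
    have h1 := integral_bernoulliFun_mul 1 (hf 1) (hc 2)
    have e2 := bernoulliFun_endpoints_eq_of_ne_one (k := 2) (by norm_num)
    have e0 := bernoulliFun_eval_zero 2
    simp only [zero_add, Nat.reduceAdd] at h0 h1
    rw [e2, e0] at h1
    rw [h1] at h0
    simp only [zero_add, mul_one, Finset.Icc_self, Finset.sum_singleton, Nat.reduceSub]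
    simp only [bernoulliFun_zero, bernoulliFun_one, Nat.factorial_zero, Nat.factorial_one,
      Nat.cast_one, div_one, one_mul] at h0
    linarith
  | succ m ih =>
    have h0 := integral_bernoulliFun_mul (2 * (m + 1)) (hf _) (hc (2 * (m + 1) + 1))
    have h1 := integral_bernoulliFun_mul (2 * (m + 1) + 1) (hf _) (hc (2 * (m + 1) + 1 + 1))
    have e2 := bernoulliFun_endpoints_eq_of_ne_one (k := 2 * (m + 1) + 1) (by omega)
    -- Odd Bernoulli numbers of index at least 3 vanish, so of each two integrations by parts only
    -- the second leaves a boundary term.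
    have e0 : bernoulliFun (2 * (m + 1) + 1) 0 = 0 := by
      rw [bernoulliFun_eval_zero, bernoulli_eq_zero_of_odd ⟨m + 1, rfl⟩ (by omega)]
      simp
    have e3 := bernoulliFun_endpoints_eq_of_ne_one (k := 2 * (m + 1) + 1 + 1) (by omega)
    have e4 := bernoulliFun_eval_zero (2 * (m + 1) + 1 + 1)
    rw [e3, e4] at h1
    rw [e2, e0, h1] at h0
    rw [Finset.sum_Icc_succ_top (by omega), ih, h0]
    have : 2 * (m + 1 + 1) = 2 * (m + 1) + 1 + 1 := by ring
    rw [this, Nat.add_sub_cancel]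
    ring

/-- **Euler–Maclaurin summation** with a remainder controlled by the `2N`-th derivative. -/
theorem euler_maclaurin (N : ℕ) (hN : 1 ≤ N) : ∃ C : ℝ, 0 ≤ C ∧ ∀ (f : ℕ → ℝ → ℝ) (M : ℕ),
    (∀ k, ∀ t ∈ Set.Icc (0 : ℝ) M, HasDerivAt (f k) (f (k + 1) t) t) →
    |(∑ l ∈ Finset.range (M + 1), f 0 l) - (∫ t in (0 : ℝ)..M, f 0 t) - (f 0 0 + f 0 M) / 2
      - ∑ r ∈ Finset.Icc 1 (N - 1), (bernoulli (2 * r) : ℝ) / (2 * r).factorial *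
          (f (2 * r - 1) M - f (2 * r - 1) 0)| ≤ C * ∫ t in (0 : ℝ)..M, |f (2 * N) t| := by
  obtain ⟨m, rfl⟩ : ∃ m, N = m + 1 := ⟨N - 1, by omega⟩
  -- The boundary term `r = N` is an integral of the `2N`-th derivative, so it is absorbed into the
  -- remainder. This is why the sum stops at `N - 1`; the bound `C` of the resulting kernel depends
  -- on `N` alone.
  set K : ℝ → ℝ := fun t => (bernoulli (2 * (m + 1)) : ℝ) / (2 * (m + 1)).factorial
    - bernoulliFun (2 * (m + 1)) t / (2 * (m + 1)).factorial with hK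
  have hKc : Continuous K := by fun_prop
  obtain ⟨C, hC⟩ := (isCompact_Icc (a := (0 : ℝ)) (b := 1)).exists_bound_of_continuousOn
    hKc.continuousOn
  have hC0 : 0 ≤ C := (norm_nonneg _).trans (hC 0 (by simp))
  refine ⟨C, hC0, fun f M => ?_⟩
  simp only [Nat.add_sub_cancel]
  induction M with
  | zero => intro _; simp
  | succ M ih =>
    intro hf
    have hf' : ∀ k, ∀ t ∈ Set.Icc (0 : ℝ) M, HasDerivAt (f k) (f (k + 1) t) t := fun k t ht =>
      hf k t ⟨ht.1, ht.2.trans (by push_cast; linarith)⟩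
    have hM : (0 : ℝ) ≤ M := Nat.cast_nonneg M
    have hc : ∀ k, ContinuousOn (f k) (Set.Icc 0 ((M + 1 : ℕ) : ℝ)) := fun k t ht =>
      (hf k t ht).continuousAt.continuousWithinAt
    have hi1 : ∀ k, IntervalIntegrable (f k) volume 0 M := fun k => by
      apply ContinuousOn.intervalIntegrable
      rw [Set.uIcc_of_le hM]
      exact (hc k).mono (Set.Icc_subset_Icc_right (by push_cast; linarith))
    have hi2 : ∀ k, IntervalIntegrable (f k) volume M (M + 1 : ℕ) := fun k => by
      apply ContinuousOn.intervalIntegrable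
      rw [Set.uIcc_of_le (by push_cast; linarith)]
      exact (hc k).mono (Set.Icc_subset_Icc_left hM)
    have hs : ∀ t ∈ Set.Icc (0 : ℝ) 1, M + t ∈ Set.Icc (0 : ℝ) (M + 1 : ℕ) := fun t ht =>
      ⟨by linarith [ht.1], by push_cast; linarith [ht.2]⟩
    have hF : ∀ k, ∀ t ∈ Set.Icc (0 : ℝ) 1,
        HasDerivAt (fun t => f k (M + t)) (f (k + 1) (M + t)) t := fun k t ht =>
      HasDerivAt.comp_const_add (M : ℝ) t (hf k _ (hs t ht))
    have hFc : ContinuousOn (fun t => f (2 * (m + 1)) (M + t)) (Set.Icc 0 1) := fun t ht =>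
      (hF _ t ht).continuousAt.continuousWithinAt
    have hFi : IntervalIntegrable (fun t => f (2 * (m + 1)) (M + t)) volume 0 1 := by
      apply ContinuousOn.intervalIntegrable
      simpa using hFc
    have key := trapezoid_eq (fun k t => f k (M + t)) hF m
    have hshift : ∀ u : ℝ → ℝ, ∫ t in (0 : ℝ)..1, u (M + t) = ∫ t in (M : ℝ)..(M + 1 : ℕ), u t := by
      intro u
      rw [intervalIntegral.integral_comp_add_left]
      simp
    rw [Finset.sum_Icc_succ_top (by omega)] at key
    have hlast : f (2 * (m + 1) - 1) (M + 1) - f (2 * (m + 1) - 1) (M + 0)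
        = ∫ t in (0 : ℝ)..1, f (2 * (m + 1)) (M + t) := by
      have := integral_eq_sub_of_hasDerivAt (a := (0 : ℝ)) (b := 1)
        (f := fun t => f (2 * (m + 1) - 1) (M + t)) (f' := fun t => f (2 * (m + 1)) (M + t))
        (fun t ht => hF (2 * (m + 1) - 1) t (by simpa using ht)) hFi
      rw [this]
    have hR : (bernoulli (2 * (m + 1)) : ℝ) / (2 * (m + 1)).factorial *
          (∫ t in (0 : ℝ)..1, f (2 * (m + 1)) (M + t)) - (∫ t in (0 : ℝ)..1,
          bernoulliFun (2 * (m + 1)) t / (2 * (m + 1)).factorial * f (2 * (m + 1)) (M + t))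
        = ∫ t in (0 : ℝ)..1, K t * f (2 * (m + 1)) (M + t) := by
      rw [← intervalIntegral.integral_const_mul, ← intervalIntegral.integral_sub]
      · simp only [hK, sub_mul]
      · exact hFi.const_mul _
      · exact hFi.continuousOn_mul (by fun_prop)
    have hRb : |∫ t in (0 : ℝ)..1, K t * f (2 * (m + 1)) (M + t)|
        ≤ C * ∫ t in (M : ℝ)..(M + 1 : ℕ), |f (2 * (m + 1)) t| := by
      rw [← hshift (fun t => |f (2 * (m + 1)) t|), ← intervalIntegral.integral_const_mul,
        ← Real.norm_eq_abs]
      apply intervalIntegral.norm_integral_le_of_norm_le zero_le_one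
      · refine Eventually.of_forall fun t ht => ?_
        rw [norm_mul]
        exact mul_le_mul_of_nonneg_right (hC t ⟨ht.1.le, ht.2⟩) (norm_nonneg _)
      · exact hFi.abs.const_mul C
    have hadd : (∫ t in (0 : ℝ)..(M + 1 : ℕ), f 0 t) = (∫ t in (0 : ℝ)..M, f 0 t)
        + ∫ t in (M : ℝ)..(M + 1 : ℕ), f 0 t :=
      (integral_add_adjacent_intervals (hi1 0) (hi2 0)).symm
    have hadd' : (∫ t in (0 : ℝ)..(M + 1 : ℕ), |f (2 * (m + 1)) t|)
        = (∫ t in (0 : ℝ)..M, |f (2 * (m + 1)) t|)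
        + ∫ t in (M : ℝ)..(M + 1 : ℕ), |f (2 * (m + 1)) t| :=
      (integral_add_adjacent_intervals (hi1 _).abs (hi2 _).abs).symm
    have hsum : ∑ r ∈ Finset.Icc 1 m, (bernoulli (2 * r) : ℝ) / (2 * r).factorial *
          (f (2 * r - 1) (M + 1 : ℕ) - f (2 * r - 1) 0)
        = (∑ r ∈ Finset.Icc 1 m, (bernoulli (2 * r) : ℝ) / (2 * r).factorial *
          (f (2 * r - 1) M - f (2 * r - 1) 0))
        + ∑ r ∈ Finset.Icc 1 m, (bernoulli (2 * r) : ℝ) / (2 * r).factorial *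
          (f (2 * r - 1) (M + 1) - f (2 * r - 1) (M + 0)) := by
      rw [← Finset.sum_add_distrib]
      refine Finset.sum_congr rfl fun r _ => ?_
      push_cast
      rw [add_zero]
      ring
    rw [hlast, hshift (f 0)] at key
    have ih' := ih hf'
    rw [Finset.sum_range_succ, hadd, hadd', hsum, mul_add]
    refine le_trans (le_of_eq ?_) ((abs_add_le _ _).trans (add_le_add ih' hRb))
    rw [← hR]
    congr 1
    simp only [add_zero] at key ⊢
    push_cast at key ⊢
    linarith

/-! ### Shifted harmonic sums and the digamma expansion -/

/-- The shifted harmonic sum `∑_{l ≤ m} 1 / (l + y)`, normalised by `log (m + y)`. -/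
noncomputable def shiftedHarmonic (y : ℝ) (m : ℕ) : ℝ :=
  (∑ l ∈ Finset.range (m + 1), 1 / ((l : ℝ) + y)) - Real.log (m + y)

/-- The asymptotic expansion in `y` of the limit of `shiftedHarmonic y`. -/
noncomputable def stirlingPart (N : ℕ) (y : ℝ) : ℝ :=
  -Real.log y + 1 / (2 * y) +
    ∑ r ∈ Finset.Icc 1 (N - 1), (bernoulli (2 * r) : ℝ) / (2 * r) / y ^ (2 * r)

/-- The `k`-th derivative of `t ↦ 1 / (t + y)`. -/
noncomputable def invDeriv (y : ℝ) (k : ℕ) (t : ℝ) : ℝ :=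
  (-1) ^ k * k.factorial / (t + y) ^ (k + 1)

theorem hasDerivAt_invDeriv (y : ℝ) (k : ℕ) {t : ℝ} (ht : t + y ≠ 0) :
    HasDerivAt (invDeriv y k) (invDeriv y (k + 1) t) t := by
  have h1 : HasDerivAt (fun t : ℝ => (t + y) ^ (k + 1)) ((k + 1 : ℕ) * (t + y) ^ k) t := by
    simpa using ((hasDerivAt_id t).add_const y).fun_pow (k + 1)
  have h2 := (h1.inv (pow_ne_zero _ ht)).const_mul ((-1) ^ k * (k.factorial : ℝ))
  convert! h2 using 1
  simp only [invDeriv, Nat.factorial_succ]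
  push_cast
  field_simp
  ring

theorem tendsto_const_div_add_pow (c y : ℝ) {k : ℕ} (hk : k ≠ 0) :
    Tendsto (fun m : ℕ => c / ((m : ℝ) + y) ^ k) atTop (𝓝 0) := by
  apply Tendsto.const_div_atTop
  exact (tendsto_pow_atTop hk).comp
    (tendsto_atTop_add_const_right _ _ tendsto_natCast_atTop_atTop)

/-- Euler–Maclaurin for `1/(t + y)` on `[0, m]`. The sequence `e` collects the boundary terms at the
far end `m`. The limit in `m`, which is `-ψ(y)`, is not needed here: each application supplies the
limit in its own closed form and passes to it in this bound. -/
theorem shiftedHarmonic_bound (N : ℕ) (hN : 1 ≤ N) : ∃ C : ℝ, 0 ≤ C ∧ ∀ y : ℝ, 0 < y →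
    ∃ e : ℕ → ℝ, Tendsto e atTop (𝓝 0) ∧
      ∀ m, |shiftedHarmonic y m - stirlingPart N y - e m| ≤ C / y ^ (2 * N) := by
  obtain ⟨C, hC, h⟩ := euler_maclaurin N hN
  refine ⟨C * (2 * N - 1).factorial, by positivity, fun y hy =>
    ⟨fun m => 1 / 2 / ((m : ℝ) + y) ^ 1 + ∑ r ∈ Finset.Icc 1 (N - 1),
      (bernoulli (2 * r) : ℝ) / (2 * r).factorial * invDeriv y (2 * r - 1) m, ?_, fun m => ?_⟩⟩
  · rw [show (0 : ℝ) = 0 + ∑ r ∈ Finset.Icc 1 (N - 1),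
      (bernoulli (2 * r) : ℝ) / (2 * r).factorial * 0 by simp]
    refine (tendsto_const_div_add_pow _ _ one_ne_zero).add
      (tendsto_finsetSum _ fun r _ => Tendsto.const_mul _ ?_)
    exact tendsto_const_div_add_pow _ _ (by omega)
  · have hm : (0 : ℝ) ≤ m := Nat.cast_nonneg m
    have hpos : ∀ t ∈ Set.Icc (0 : ℝ) m, 0 < t + y := fun t ht => by linarith [ht.1]
    have hd : ∀ k, ∀ t ∈ Set.Icc (0 : ℝ) m,
        HasDerivAt (invDeriv y k) (invDeriv y (k + 1) t) t := fun k t ht =>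
      hasDerivAt_invDeriv y k (hpos t ht).ne'
    have hint : ∀ k, IntervalIntegrable (invDeriv y k) MeasureTheory.volume 0 m := fun k => by
      apply ContinuousOn.intervalIntegrable
      rw [Set.uIcc_of_le hm]
      exact fun t ht => (hd k t ht).continuousAt.continuousWithinAt
    have h0 : ∫ t in (0 : ℝ)..m, invDeriv y 0 t = Real.log (m + y) - Real.log y := by
      rw [intervalIntegral.integral_eq_sub_of_hasDerivAt (f := fun t => Real.log (t + y)) _
        (hint 0)]
      · simp
      · intro t ht
        rw [Set.uIcc_of_le hm] at ht
        simpa [invDeriv] using ((hasDerivAt_id t).add_const y).log (hpos t ht).ne'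
    have hN2 : 2 * N - 1 + 1 = 2 * N := by omega
    -- Even derivatives of `1/(t + y)` are positive, so the integral of the absolute value
    -- telescopes, and the far endpoint contributes with a favourable sign.
    have habs : ∫ t in (0 : ℝ)..m, |invDeriv y (2 * N) t| ≤ (2 * N - 1).factorial / y ^ (2 * N) := by
      have e1 : ∫ t in (0 : ℝ)..m, |invDeriv y (2 * N) t| = ∫ t in (0 : ℝ)..m, invDeriv y (2 * N) t := by
        apply intervalIntegral.integral_congr
        intro t ht
        rw [Set.uIcc_of_le hm] at ht
        have := hpos t ht
        apply abs_of_nonneg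
        rw [invDeriv, Even.neg_one_pow ⟨N, by ring⟩]
        positivity
      have hodd : (-1 : ℝ) ^ (2 * N - 1) = -1 := Odd.neg_one_pow ⟨N - 1, by omega⟩
      have e2 := intervalIntegral.integral_eq_sub_of_hasDerivAt (a := (0 : ℝ)) (b := m)
        (f := invDeriv y (2 * N - 1)) (f' := invDeriv y (2 * N))
        (fun t ht => by
          rw [Set.uIcc_of_le hm] at ht
          have := hd (2 * N - 1) t ht
          rwa [hN2] at this) (hint _)
      rw [e1, e2, invDeriv, invDeriv, hodd, hN2, zero_add]
      have : 0 ≤ ((2 * N - 1).factorial : ℝ) / (m + y) ^ (2 * N) := by positivity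
      have e3 : ∀ z : ℝ, -1 * ((2 * N - 1).factorial : ℝ) / z = -(((2 * N - 1).factorial : ℝ) / z) :=
        fun z => by ring
      rw [e3, e3]
      linarith
    have key := h (invDeriv y) m hd
    rw [h0] at key
    refine le_trans (le_of_eq ?_) (key.trans (by
      rw [mul_div_assoc]; exact mul_le_mul_of_nonneg_left habs hC))
    have hs : ∑ r ∈ Finset.Icc 1 (N - 1), (bernoulli (2 * r) : ℝ) / (2 * r).factorial *
          (invDeriv y (2 * r - 1) m - invDeriv y (2 * r - 1) 0)
        = (∑ r ∈ Finset.Icc 1 (N - 1),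
            (bernoulli (2 * r) : ℝ) / (2 * r).factorial * invDeriv y (2 * r - 1) m)
          + ∑ r ∈ Finset.Icc 1 (N - 1), (bernoulli (2 * r) : ℝ) / (2 * r) / y ^ (2 * r) := by
      rw [← Finset.sum_add_distrib]
      refine Finset.sum_congr rfl fun r hr => ?_
      have hr1 := (Finset.mem_Icc.1 hr).1
      obtain ⟨q, rfl⟩ : ∃ q, r = q + 1 := ⟨r - 1, by omega⟩
      have e : 2 * (q + 1) = 2 * q + 1 + 1 := by ring
      have hodd : (-1 : ℝ) ^ (2 * q + 1) = -1 := Odd.neg_one_pow ⟨q, rfl⟩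
      have hfac : ((2 * q + 1).factorial : ℝ) ≠ 0 := by positivity
      rw [mul_sub, sub_eq_add_neg]
      congr 1
      simp only [invDeriv, e, Nat.add_sub_cancel, hodd, Nat.factorial_succ (2 * q + 1), zero_add]
      push_cast
      field_simp
      ring
    rw [hs]
    simp only [shiftedHarmonic, stirlingPart, invDeriv, pow_zero, Nat.factorial_zero, zero_add,
      pow_one, Nat.cast_one, mul_one]
    congr 1
    have : (1 : ℝ) / (2 * y) = 1 / y / 2 := by ring
    rw [this]
    ring

/-- For `y = n` the shifted sum is `H_{m+n} - H_{n-1}`, so the limit is expressed through `γ`. -/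
theorem harmonic_bound (N : ℕ) (hN : 1 ≤ N) : ∃ C : ℝ, 0 ≤ C ∧ ∀ n : ℕ, 1 ≤ n →
    |Real.eulerMascheroniConstant - (harmonic n : ℝ) + 1 / n - stirlingPart N n|
      ≤ C / (n : ℝ) ^ (2 * N) := by
  obtain ⟨C, hC, h⟩ := shiftedHarmonic_bound N hN
  refine ⟨C, hC, fun n hn => ?_⟩
  obtain ⟨e, he, hb⟩ := h n (by exact_mod_cast hn)
  have hsum : ∀ m : ℕ, ∑ l ∈ Finset.range (m + 1), 1 / ((l : ℝ) + n)
      = (harmonic (m + n) : ℝ) - harmonic n + 1 / n := by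
    intro m
    induction m with
    | zero => simp
    | succ m ih =>
      rw [Finset.sum_range_succ, ih, show m + 1 + n = m + n + 1 by ring, harmonic_succ]
      push_cast
      rw [one_div ((m : ℝ) + 1 + n), show (m : ℝ) + 1 + n = m + n + 1 by ring]
      ring
  have hlim : Tendsto (shiftedHarmonic n) atTop
      (𝓝 (Real.eulerMascheroniConstant - (harmonic n : ℝ) + 1 / n)) := by
    have h1 := (Real.tendsto_harmonic_sub_log.comp (tendsto_add_atTop_nat n)).sub_const
      ((harmonic n : ℝ) - 1 / n)
    have e1 : Real.eulerMascheroniConstant - ((harmonic n : ℝ) - 1 / n)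
      = Real.eulerMascheroniConstant - (harmonic n : ℝ) + 1 / n := by ring
    rw [e1] at h1
    refine h1.congr fun m => ?_
    simp only [shiftedHarmonic, hsum, Function.comp]
    push_cast
    ring
  have := ((hlim.sub_const (stirlingPart N n)).sub he).abs
  rw [sub_zero] at this
  exact le_of_tendsto' this hb

/-! ### Cotangent partial fractions and the pole sum -/

theorem tendsto_cot_partialFractions {x : ℝ} (hx : ∀ k : ℤ, x ≠ k) :
    Tendsto (fun m : ℕ => ∑ j ∈ Finset.range m, (1 / (x - (j + 1)) + 1 / (x + (j + 1)))) atTop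
      (𝓝 (Real.pi * Real.cot (Real.pi * x) - 1 / x)) := by
  have hz : (x : ℂ) ∈ Complex.integerComplement := by
    rintro ⟨k, hk⟩
    apply hx k
    exact_mod_cast hk.symm
  have h := tendsto_logDeriv_euler_cot_sub hz
  rw [← Filter.tendsto_ofReal_iff]
  convert! h using 1
  · ext m
    simp [cotTerm]
  · simp

/-- The finite pole sum in terms of the cotangent and the expansion of the digamma function. -/
theorem poleSum_bound (N : ℕ) (hN : 1 ≤ N) : ∃ C : ℝ, 0 ≤ C ∧ ∀ (n : ℕ) (x : ℝ), 0 < x → x < n →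
    (∀ k : ℤ, x ≠ k) →
    |(∑ l ∈ Finset.Ico 1 n, 1 / ((l : ℝ) - x)) + Real.pi * Real.cot (Real.pi * x)
      + (stirlingPart N (n - x) - stirlingPart N x)|
      ≤ C / ((n : ℝ) - x) ^ (2 * N) + C / x ^ (2 * N) := by
  obtain ⟨C, hC, h⟩ := shiftedHarmonic_bound N hN
  refine ⟨C, hC, fun n x hx hxn hk => ?_⟩
  obtain ⟨e, he, hb⟩ := h (n - x) (by linarith)
  obtain ⟨e', he', hb'⟩ := h x hx
  have hn : 1 ≤ n := by
    rcases Nat.eq_zero_or_pos n with rfl | h0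
    · simp at hxn; linarith
    · exact h0
  -- A finite form of the digamma reflection formula. Truncating at `m` for shift `n - x` and at `m
  -- + n` for shift `x` makes both sums end at the same index, so they pair into symmetric partial
  -- fractions, up to the pole sum and `1/x`.
  have hsum : ∀ m : ℕ, (∑ l ∈ Finset.range (m + 1), 1 / ((l : ℝ) + (n - x)))
      - (∑ l ∈ Finset.range (m + n + 1), 1 / ((l : ℝ) + x))
      = -(∑ j ∈ Finset.range (m + n), (1 / (x - (j + 1)) + 1 / (x + (j + 1))))
        - 1 / x - ∑ l ∈ Finset.Ico 1 n, 1 / ((l : ℝ) - x) := by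
    intro m
    have a1 : ∑ l ∈ Finset.range (m + 1), 1 / ((l : ℝ) + (n - x))
        = (∑ l ∈ Finset.range (m + n), 1 / ((l : ℝ) + 1 - x))
          - ∑ l ∈ Finset.Ico 1 n, 1 / ((l : ℝ) - x) := by
      have b1 : ∑ l ∈ Finset.range (m + n), 1 / ((l : ℝ) + 1 - x)
          = ∑ l ∈ Finset.Ico 1 (m + n + 1), 1 / ((l : ℝ) - x) := by
        rw [Finset.sum_Ico_eq_sum_range]
        refine Finset.sum_congr (by simp) fun l _ => ?_
        push_cast; ring
      have b2 : ∑ l ∈ Finset.range (m + 1), 1 / ((l : ℝ) + (n - x))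
          = ∑ l ∈ Finset.Ico n (m + n + 1), 1 / ((l : ℝ) - x) := by
        rw [Finset.sum_Ico_eq_sum_range]
        refine Finset.sum_congr (by congr 1; omega) fun l _ => ?_
        push_cast; ring
      rw [b1, b2, ← Finset.sum_Ico_consecutive _ hn (by omega : n ≤ m + n + 1)]
      ring
    have a2 : ∑ l ∈ Finset.range (m + n + 1), 1 / ((l : ℝ) + x)
        = (∑ l ∈ Finset.range (m + n), 1 / (x + ((l : ℝ) + 1))) + 1 / x := by
      rw [Finset.sum_range_succ']
      simp only [Nat.cast_add, Nat.cast_one, Nat.cast_zero, zero_add]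
      congr 1
      exact Finset.sum_congr rfl fun l _ => by rw [add_comm]
    rw [a1, a2, Finset.sum_add_distrib]
    have a3 : ∑ j ∈ Finset.range (m + n), 1 / (x - ((j : ℝ) + 1))
        = -∑ l ∈ Finset.range (m + n), 1 / ((l : ℝ) + 1 - x) := by
      rw [← Finset.sum_neg_distrib]
      refine Finset.sum_congr rfl fun l _ => ?_
      rw [← neg_sub, one_div_neg_eq_neg_one_div]
    rw [a3]
    ring
  have hlog : Tendsto (fun m : ℕ => Real.log (m + (n - x)) - Real.log ((m + n : ℕ) + x)) atTop
      (𝓝 0) := by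
    have h1 : Tendsto (fun m : ℕ => (1 : ℝ) - 2 * x / ((m : ℝ) + (n + x)) ^ 1) atTop (𝓝 (1 - 0)) :=
      (tendsto_const_div_add_pow _ _ one_ne_zero).const_sub 1
    rw [sub_zero] at h1
    have h2 := (Real.continuousAt_log one_ne_zero).tendsto.comp h1
    rw [Real.log_one] at h2
    refine h2.congr fun m => ?_
    have hm : (0 : ℝ) ≤ m := Nat.cast_nonneg m
    have p1 : 0 < (m : ℝ) + (n + x) := by linarith
    have p2 : 0 < (m : ℝ) + (n - x) := by linarith
    have p3 : ((m + n : ℕ) : ℝ) + x = m + (n + x) := by push_cast; ring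
    rw [p3, ← Real.log_div p2.ne' p1.ne', Function.comp]
    congr 1
    field_simp
    ring
  have hlim : Tendsto (fun m => shiftedHarmonic (n - x) m - shiftedHarmonic x (m + n)) atTop
      (𝓝 (-(Real.pi * Real.cot (Real.pi * x)) - ∑ l ∈ Finset.Ico 1 n, 1 / ((l : ℝ) - x))) := by
    have h1 := (((((tendsto_cot_partialFractions hk).comp (tendsto_add_atTop_nat n)).neg).sub_const
      (1 / x)).sub_const (∑ l ∈ Finset.Ico 1 n, 1 / ((l : ℝ) - x))).sub hlog
    have e1 : -(Real.pi * Real.cot (Real.pi * x) - 1 / x) - 1 / x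
        - (∑ l ∈ Finset.Ico 1 n, 1 / ((l : ℝ) - x)) - 0
      = -(Real.pi * Real.cot (Real.pi * x)) - ∑ l ∈ Finset.Ico 1 n, 1 / ((l : ℝ) - x) := by ring
    rw [e1] at h1
    refine h1.congr fun m => ?_
    simp only [Function.comp]
    rw [← hsum m, shiftedHarmonic, shiftedHarmonic]
    ring
  have hfin := ((hlim.sub_const (stirlingPart N (n - x) - stirlingPart N x)).sub
    (he.sub (he'.comp (tendsto_add_atTop_nat n)))).abs
  have hle := le_of_tendsto' hfin (b := C / ((n : ℝ) - x) ^ (2 * N) + C / x ^ (2 * N)) fun m => by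
    refine le_trans (le_of_eq ?_) ((abs_sub _ _).trans (add_le_add (hb m) (hb' (m + n))))
    simp only [Function.comp]
    congr 1
    ring
  rw [← abs_neg]
  refine le_trans (le_of_eq ?_) hle
  congr 1
  ring

/-! ### Taylor coefficients of the cosecant at the origin -/

/-- The formal Taylor series at `0`. -/
noncomputable def taylorSeries (f : ℝ → ℝ) : PowerSeries ℝ :=
  PowerSeries.mk fun n => iteratedDeriv n f 0 / n.factorial

theorem taylorSeries_mul {f g : ℝ → ℝ} (hf : AnalyticAt ℝ f 0) (hg : AnalyticAt ℝ g 0) :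
    taylorSeries (fun x => f x * g x) = taylorSeries f * taylorSeries g := by
  ext n
  rw [PowerSeries.coeff_mul, Finset.Nat.sum_antidiagonal_eq_sum_range_succ
    (fun i j => (taylorSeries f).coeff i * (taylorSeries g).coeff j)]
  simp only [taylorSeries, PowerSeries.coeff_mk]
  rw [iteratedDeriv_fun_mul hf.contDiffAt hg.contDiffAt, Finset.sum_div]
  refine Finset.sum_congr rfl fun i hi => ?_
  have hin : i ≤ n := Nat.lt_succ_iff.1 (Finset.mem_range.1 hi)
  rw [Nat.cast_choose ℝ hin]
  have : (n.factorial : ℝ) ≠ 0 := by positivity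
  field_simp

theorem taylorSeries_add {f g : ℝ → ℝ} (hf : AnalyticAt ℝ f 0) (hg : AnalyticAt ℝ g 0) :
    taylorSeries (fun x => f x + g x) = taylorSeries f + taylorSeries g := by
  ext n
  simp only [taylorSeries, PowerSeries.coeff_mk, map_add]
  rw [iteratedDeriv_fun_add hf.contDiffAt hg.contDiffAt, add_div]

theorem taylorSeries_one : taylorSeries (fun _ => 1) = 1 := by
  ext n
  rw [taylorSeries, PowerSeries.coeff_mk, PowerSeries.coeff_one, iteratedDeriv_const]
  split_ifs with h
  · simp [h]
  · simp

theorem taylorSeries_id : taylorSeries (fun x => x) = PowerSeries.X := by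
  ext n
  rw [taylorSeries, PowerSeries.coeff_mk, PowerSeries.coeff_X, iteratedDeriv_fun_id_zero]
  split_ifs with h
  · simp [h]
  · simp

theorem taylorSeries_sin : taylorSeries Real.sin = PowerSeries.sin ℝ := by
  ext n
  rw [taylorSeries, PowerSeries.sin, PowerSeries.coeff_mk, PowerSeries.coeff_mk]
  rcases Nat.even_or_odd' n with ⟨k, rfl | rfl⟩
  · simp
  · simp [show (2 * k + 1) / 2 = k by omega]

theorem taylorSeries_congr {f g : ℝ → ℝ} (h : f =ᶠ[𝓝 0] g) : taylorSeries f = taylorSeries g := by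
  ext n
  simp only [taylorSeries, PowerSeries.coeff_mk, h.iteratedDeriv_eq n]

/-- The regular part of the cosecant at `0` is real analytic; its value there is `0`. -/
theorem analyticAt_csc_sub_inv : AnalyticAt ℝ (fun x => csc x - x⁻¹) 0 := by
  have hs : AnalyticAt ℝ Real.sinc 0 := by
    rw [Real.sinc_eq_dslope]
    obtain ⟨p, hp⟩ := Real.analyticAt_sin (x := 0)
    exact ⟨_, hp.has_fpower_series_dslope_fslope⟩
  have hu : AnalyticAt ℝ (fun x => (Real.sinc x)⁻¹) 0 := hs.inv (by simp)
  -- Away from `0`, `csc x - 1/x` is the difference quotient of `1/sinc` at `0`. Evenness of `sinc`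
  -- makes the quotient's value at `0` agree with the default value `0` produced by division by
  -- zero.
  have heven : deriv (fun x => (Real.sinc x)⁻¹) 0 = 0 := by
    have h := deriv_comp_neg (fun x => (Real.sinc x)⁻¹) 0
    simp only [Real.sinc_neg, neg_zero] at h
    linarith
  obtain ⟨p, hp⟩ := hu
  have hd : AnalyticAt ℝ (dslope (fun x => (Real.sinc x)⁻¹) 0) 0 :=
    ⟨_, hp.has_fpower_series_dslope_fslope⟩
  convert! hd using 1
  ext x
  rcases eq_or_ne x 0 with rfl | hx
  · simp [csc, heven]
  · rw [dslope_of_ne _ hx, slope_def_field, Real.sinc_of_ne_zero hx, Real.sinc_zero, csc]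
    field_simp
    ring

theorem analyticAt_csc {x : ℝ} (hx : Real.sin x ≠ 0) : AnalyticAt ℝ csc x :=
  analyticAt_const.div Real.analyticAt_sin hx

/-- The identity `(x / sin x) * sin x = x` at the level of formal series; it determines the series
of `x / sin x`. -/
theorem csc_taylorSeries_mul_sin :
    (1 + PowerSeries.X * taylorSeries (fun x => csc x - x⁻¹)) * PowerSeries.sin ℝ
      = PowerSeries.X := by
  have h : (fun x : ℝ => (1 + x * (csc x - x⁻¹)) * Real.sin x) =ᶠ[𝓝 0] fun x => x := by
    filter_upwards [Ioo_mem_nhds (neg_lt_zero.2 Real.pi_pos) Real.pi_pos] with x hx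
    rcases eq_or_ne x 0 with rfl | hx0
    · simp
    · have hs : Real.sin x ≠ 0 := by
        intro h
        exact hx0 ((Real.sin_eq_zero_iff_of_lt_of_lt hx.1 hx.2).1 h)
      rw [csc]
      field_simp
      ring
  have hid : AnalyticAt ℝ (fun x : ℝ => x) 0 := analyticAt_id
  have h1 := hid.fun_mul analyticAt_csc_sub_inv
  rw [← taylorSeries_id, ← taylorSeries_sin, ← taylorSeries_one, ← taylorSeries_mul hid
    analyticAt_csc_sub_inv, ← taylorSeries_add analyticAt_const h1, ← taylorSeries_mul
    (analyticAt_const.fun_add h1) Real.analyticAt_sin]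
  exact taylorSeries_congr h

open PowerSeries in
theorem sin_eq_exp_sub_exp :
    C (2 * Complex.I) * PowerSeries.sin ℂ
      = rescale Complex.I (exp ℂ) - rescale (-Complex.I) (exp ℂ) := by
  ext n
  rw [coeff_C_mul, map_sub, coeff_rescale, coeff_rescale, coeff_exp, PowerSeries.sin, coeff_mk]
  rcases Nat.even_or_odd' n with ⟨k, rfl | rfl⟩
  · simp
  · rw [if_neg (by simp), Odd.neg_pow ⟨k, rfl⟩, pow_succ, pow_mul, Complex.I_sq,
      show (2 * k + 1) / 2 = k by omega]
    simp only [one_div, eq_ratCast]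
    push_cast
    ring

open PowerSeries in
-- With `b(z) = z/(e^z - 1)` and `E = e^{ix}`, one has `x / sin x = 2ixE/(E² - 1) = 2b(ix) -
-- b(2ix)`. The proof clears the denominator `E² - 1`, which is a nonzero series.
theorem one_add_X_mul_eq_bernoulli {G : PowerSeries ℂ}
    (hG : (1 + X * G) * PowerSeries.sin ℂ = X) :
    1 + X * G = 2 * rescale Complex.I (bernoulliPowerSeries ℂ)
      - rescale (2 * Complex.I) (bernoulliPowerSeries ℂ) := by
  set E := rescale Complex.I (exp ℂ) with hE
  set E2 := rescale (2 * Complex.I) (exp ℂ) with hE2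
  have hEE : E * E = E2 := by
    rw [hE, hE2, exp_mul_exp_eq_exp_add, two_mul]
  have hEn : rescale (-Complex.I) (exp ℂ) * E = 1 := by
    rw [hE, exp_mul_exp_eq_exp_add]
    simp
  have hb1 : rescale Complex.I (bernoulliPowerSeries ℂ) * (E - 1) = C Complex.I * X := by
    have := congrArg (rescale Complex.I) (bernoulliPowerSeries_mul_exp_sub_one ℂ)
    rwa [map_mul, map_sub, map_one, rescale_X] at this
  have hb2 : rescale (2 * Complex.I) (bernoulliPowerSeries ℂ) * (E2 - 1)
      = C (2 * Complex.I) * X := by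
    have := congrArg (rescale (2 * Complex.I)) (bernoulliPowerSeries_mul_exp_sub_one ℂ)
    rwa [map_mul, map_sub, map_one, rescale_X] at this
  have hne : E2 - 1 ≠ 0 := by
    intro h
    rw [h, mul_zero] at hb2
    have := congrArg (coeff 1) hb2
    simp at this
  have hs : (1 + X * G) * (E2 - 1) = C (2 * Complex.I) * X * E := by
    calc (1 + X * G) * (E2 - 1)
        = (1 + X * G) * ((E - rescale (-Complex.I) (exp ℂ)) * E) := by
          rw [sub_mul, hEn, hEE]
      _ = C (2 * Complex.I) * ((1 + X * G) * PowerSeries.sin ℂ) * E := by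
          rw [← sin_eq_exp_sub_exp]; ring
      _ = C (2 * Complex.I) * X * E := by rw [hG]
  apply mul_right_cancel₀ hne
  have h2 : C (2 * Complex.I) = 2 * C Complex.I := by rw [map_mul, map_ofNat]
  rw [hs, sub_mul, hb2, h2, ← hEE]
  linear_combination (-2 * (E + 1)) * hb1

/-- The odd Taylor coefficients of the regular part of the cosecant at `0`. -/
theorem iteratedDeriv_csc_sub_inv (r : ℕ) (hr : 1 ≤ r) :
    iteratedDeriv (2 * r - 1) (fun x => csc x - x⁻¹) 0
      = ((2 : ℝ) ^ (2 * r) - 2) * (-1) ^ (r + 1) * (bernoulli (2 * r) : ℝ) / (2 * r) := by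
  obtain ⟨q, rfl⟩ : ∃ q, r = q + 1 := ⟨r - 1, by omega⟩
  have h := congrArg (PowerSeries.map Complex.ofRealHom) csc_taylorSeries_mul_sin
  rw [map_mul, map_add, map_one, map_mul, PowerSeries.map_X, PowerSeries.map_sin] at h
  have h2 := congrArg (PowerSeries.coeff (2 * q + 1 + 1)) (one_add_X_mul_eq_bernoulli h)
  rw [map_add, PowerSeries.coeff_succ_X_mul, PowerSeries.coeff_map, taylorSeries,
    PowerSeries.coeff_mk, PowerSeries.coeff_one, if_neg (by omega), zero_add, map_sub,
    PowerSeries.coeff_rescale,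
    show (2 : PowerSeries ℂ) = PowerSeries.C 2 from (map_ofNat _ 2).symm, PowerSeries.coeff_C_mul,
    PowerSeries.coeff_rescale, bernoulliPowerSeries, PowerSeries.coeff_mk, mul_pow,
    show 2 * q + 1 + 1 = 2 * (q + 1) by ring, pow_mul Complex.I, Complex.I_sq] at h2
  have h3 : iteratedDeriv (2 * q + 1) (fun x => csc x - x⁻¹) 0 / ((2 * q + 1).factorial : ℝ)
      = (2 - 2 ^ (2 * (q + 1))) * (-1) ^ (q + 1) *
        ((bernoulli (2 * (q + 1)) : ℝ) / ((2 * (q + 1)).factorial : ℝ)) := by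
    apply Complex.ofReal_injective
    refine Eq.trans h2 ?_
    simp only [eq_ratCast]
    push_cast
    ring
  have hf : ((2 * q + 1).factorial : ℝ) ≠ 0 := by positivity
  rw [show 2 * (q + 1) - 1 = 2 * q + 1 by omega, (div_eq_iff hf).1 h3,
    show (2 * (q + 1)).factorial = (2 * q + 1 + 1) * (2 * q + 1).factorial from
      Nat.factorial_succ _]
  push_cast
  field_simp
  ring

/-! ### Equidistant samples and the regular part of the cosecant -/

/-- Euler–Maclaurin for the equidistant samples of a real analytic function on `[0, L]`. -/
theorem euler_maclaurin_samples {g : ℝ → ℝ} {L : ℝ} (hL : 0 < L)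
    (hg : ∀ t ∈ Set.Icc 0 L, AnalyticAt ℝ g t) (N : ℕ) (hN : 1 ≤ N) :
    ∃ C : ℝ, 0 ≤ C ∧ ∀ n : ℕ, 1 ≤ n →
      |(∑ l ∈ Finset.range (n + 1), g (L / n * l)) - (n / L) * (∫ t in (0 : ℝ)..L, g t)
        - (g 0 + g L) / 2
        - ∑ r ∈ Finset.Icc 1 (N - 1), (bernoulli (2 * r) : ℝ) / (2 * r).factorial *
          ((L / n) ^ (2 * r - 1) * (iteratedDeriv (2 * r - 1) g L - iteratedDeriv (2 * r - 1) g 0))|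
      ≤ C / (n : ℝ) ^ (2 * N - 1) := by
  obtain ⟨C, hC, h⟩ := euler_maclaurin N hN
  have hA : ∀ k, ∀ t ∈ Set.Icc 0 L, AnalyticAt ℝ (iteratedDeriv k g) t := fun k t ht => by
    rw [iteratedDeriv_eq_iterate]
    exact (hg t ht).iterated_deriv k
  obtain ⟨D, hD⟩ := (isCompact_Icc (a := (0 : ℝ)) (b := L)).exists_bound_of_continuousOn
    (f := iteratedDeriv (2 * N) g) fun t ht => (hA _ t ht).continuousAt.continuousWithinAt
  have hD0 : 0 ≤ D := (norm_nonneg _).trans (hD 0 ⟨le_rfl, hL.le⟩)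
  refine ⟨C * (L ^ (2 * N) * D), by positivity, fun n hn => ?_⟩
  have hn0 : (0 : ℝ) < n := by exact_mod_cast hn
  have hh : 0 < L / n := by positivity
  have hmem : ∀ t ∈ Set.Icc (0 : ℝ) n, L / n * t ∈ Set.Icc 0 L := fun t ht =>
    ⟨mul_nonneg hh.le ht.1, by
      calc L / n * t ≤ L / n * n := mul_le_mul_of_nonneg_left ht.2 hh.le
        _ = L := by field_simp⟩
  -- After rescaling to `[0, n]` each derivative brings a factor `L/n`. The `2N`-th derivative is
  -- `O(n^(-2N))` and the interval has length `n`, whence the exponent `2N - 1`.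
  have key := h (fun k t => (L / n) ^ k * iteratedDeriv k g (L / n * t)) n (fun k t ht => by
    have h1 := (hA k _ (hmem t ht)).differentiableAt.hasDerivAt
    rw [← iteratedDeriv_succ] at h1
    have h2 := (h1.comp t ((hasDerivAt_id t).const_mul (L / n))).const_mul ((L / n) ^ k)
    convert! h2 using 1
    rw [pow_succ]
    ring)
  have hint : ∫ t in (0 : ℝ)..n, g (L / n * t) = (n / L) * ∫ t in (0 : ℝ)..L, g t := by
    rw [intervalIntegral.integral_comp_mul_left g hh.ne', mul_zero, div_mul_cancel₀ L hn0.ne',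
      smul_eq_mul, inv_div]
  have hbound : ∫ t in (0 : ℝ)..n, |(L / n) ^ (2 * N) * iteratedDeriv (2 * N) g (L / n * t)|
      ≤ L ^ (2 * N) * D / (n : ℝ) ^ (2 * N - 1) := by
    have h1 := intervalIntegral.norm_integral_le_of_norm_le_const (a := (0 : ℝ)) (b := n)
      (f := fun t => |(L / n) ^ (2 * N) * iteratedDeriv (2 * N) g (L / n * t)|)
      (C := (L / n) ^ (2 * N) * D) (fun t ht => by
        rw [Set.uIoc_of_le hn0.le] at ht
        rw [Real.norm_eq_abs, abs_abs, abs_mul, abs_of_nonneg (by positivity)]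
        exact mul_le_mul_of_nonneg_left (hD _ (hmem t ⟨ht.1.le, ht.2⟩)) (by positivity))
    refine (le_abs_self _).trans (h1.trans (le_of_eq ?_))
    rw [sub_zero, abs_of_pos hn0]
    have : (n : ℝ) ^ (2 * N) = n ^ (2 * N - 1) * n := by
      rw [← pow_succ]; congr 1; omega
    rw [div_pow, this]
    field_simp
  simp only [pow_zero, one_mul, iteratedDeriv_zero, mul_zero, div_mul_cancel₀ L hn0.ne',
    hint] at key
  refine le_trans (le_of_eq ?_) (key.trans (by
    rw [mul_div_assoc]; exact mul_le_mul_of_nonneg_left hbound hC))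
  congr 2
  exact Finset.sum_congr rfl fun r _ => by ring

/-- The cosecant with its pole at `0`, and for `d = 1` also its pole at `π`, removed. -/
noncomputable def regularPart (d x : ℝ) : ℝ := csc x - x⁻¹ + d * (x - Real.pi)⁻¹

theorem analyticAt_inv_sub (c : ℝ) {x : ℝ} (hx : x ≠ c) : AnalyticAt ℝ (fun x => (x - c)⁻¹) x :=
  (analyticAt_id.fun_sub analyticAt_const).fun_inv (sub_ne_zero.2 hx)

theorem analyticAt_regularPart_zero (d : ℝ) : AnalyticAt ℝ (regularPart d) 0 :=
  analyticAt_csc_sub_inv.fun_add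
    (analyticAt_const.fun_mul (analyticAt_inv_sub Real.pi Real.pi_pos.ne))

theorem analyticAt_regularPart_of_sin_ne_zero (d : ℝ) {x : ℝ} (hx : Real.sin x ≠ 0) :
    AnalyticAt ℝ (regularPart d) x := by
  have h0 : x ≠ 0 := by rintro rfl; simp at hx
  have h1 : x ≠ Real.pi := by rintro rfl; simp at hx
  exact ((analyticAt_csc hx).fun_sub (analyticAt_id.fun_inv h0)).fun_add
    (analyticAt_const.fun_mul (analyticAt_inv_sub Real.pi h1))

/-- Since `csc x = -csc (x - π)`, near `π` this is minus the translate of the regular part at `0`,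
minus the harmless `1/x`. -/
theorem analyticAt_regularPart_pi : AnalyticAt ℝ (regularPart 1) Real.pi := by
  have h1 : AnalyticAt ℝ (fun x : ℝ => x - Real.pi) Real.pi :=
    analyticAt_id.fun_sub analyticAt_const
  have h2 : AnalyticAt ℝ (fun x => csc x - x⁻¹) (Real.pi - Real.pi) := by
    rw [sub_self]; exact analyticAt_csc_sub_inv
  have h3 := (h2.comp h1 (f := fun x : ℝ => x - Real.pi)).fun_neg.fun_sub
    (analyticAt_id.fun_inv Real.pi_pos.ne')
  convert! h3 using 1
  ext x
  simp only [regularPart, Function.comp, csc, Real.sin_sub_pi, id, one_mul, one_div, inv_neg]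
  ring

/-- As `a < 2`, the sine vanishes on `[0, aπ]` only at `0` and possibly at `π`; the latter occurs
only for `a ≥ 1`, where `delta a = 1`. -/
theorem analyticAt_regularPart {a : ℝ} (ha2 : a < 2) {t : ℝ}
    (ht : t ∈ Set.Icc 0 (a * Real.pi)) : AnalyticAt ℝ (regularPart (delta a)) t := by
  have hpi := Real.pi_pos
  rcases eq_or_ne t 0 with rfl | h0
  · exact analyticAt_regularPart_zero _
  have ht0 : 0 < t := lt_of_le_of_ne ht.1 h0.symm
  by_cases hs : Real.sin t = 0
  · have htpi : t = Real.pi := by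
      have h1 : t - Real.pi < Real.pi := by nlinarith [ht.2]
      have h2 := (Real.sin_eq_zero_iff_of_lt_of_lt (x := t - Real.pi) (by linarith) h1).1
        (by rw [Real.sin_sub_pi, hs, neg_zero])
      linarith
    subst htpi
    have h1 : ¬ a < 1 := fun h => by nlinarith [ht.2]
    rw [delta, if_neg h1]
    exact analyticAt_regularPart_pi
  · exact analyticAt_regularPart_of_sin_ne_zero _ hs

theorem iteratedDeriv_inv_sub (k : ℕ) (c x : ℝ) :
    iteratedDeriv k (fun x => (x - c)⁻¹) x = (-1) ^ k * k.factorial / (x - c) ^ (k + 1) := by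
  have h := congrFun (iter_deriv_inv_linear_sub k (1 : ℝ) c) x
  simp only [one_mul, one_pow, mul_one] at h
  rw [iteratedDeriv_eq_iterate, h, show (-1 - k : ℤ) = -((k + 1 : ℕ) : ℤ) by push_cast; ring,
    zpow_neg, zpow_natCast, div_eq_mul_inv]

theorem iteratedDeriv_regularPart_zero (d : ℝ) (r : ℕ) (hr : 1 ≤ r) :
    iteratedDeriv (2 * r - 1) (regularPart d) 0
      = ((2 : ℝ) ^ (2 * r) - 2) * (-1) ^ (r + 1) * (bernoulli (2 * r) : ℝ) / (2 * r)
        - d * ((2 * r - 1).factorial / Real.pi ^ (2 * r)) := by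
  have hp : AnalyticAt ℝ (fun x => (x - Real.pi)⁻¹) 0 := analyticAt_inv_sub _ Real.pi_pos.ne
  have h : regularPart d = fun x => (csc x - x⁻¹) + d * (x - Real.pi)⁻¹ := rfl
  rw [h, iteratedDeriv_fun_add analyticAt_csc_sub_inv.contDiffAt
    (analyticAt_const.fun_mul hp).contDiffAt, iteratedDeriv_const_mul_field,
    iteratedDeriv_csc_sub_inv r hr, iteratedDeriv_inv_sub,
    Odd.neg_one_pow (n := 2 * r - 1) ⟨r - 1, by omega⟩,
    show 2 * r - 1 + 1 = 2 * r by omega, zero_sub, Even.neg_pow (n := 2 * r) ⟨r, by ring⟩ Real.pi]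
  ring

theorem iteratedDeriv_regularPart (d : ℝ) {x : ℝ} (hx : Real.sin x ≠ 0) (r : ℕ) (hr : 1 ≤ r) :
    iteratedDeriv (2 * r - 1) (regularPart d) x
      = F (2 * r - 1) x + (2 * r - 1).factorial / x ^ (2 * r)
        - d * ((2 * r - 1).factorial / (x - Real.pi) ^ (2 * r)) := by
  have h0 : x ≠ 0 := by rintro rfl; simp at hx
  have h1 : x ≠ Real.pi := by rintro rfl; simp at hx
  have h : regularPart d = fun x => (csc x - (x - 0)⁻¹) + d * (x - Real.pi)⁻¹ := by
    ext x; simp [regularPart]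
  have hi := analyticAt_inv_sub 0 h0
  have hp := analyticAt_inv_sub Real.pi h1
  rw [h, iteratedDeriv_fun_add ((analyticAt_csc hx).fun_sub hi).contDiffAt
    (analyticAt_const.fun_mul hp).contDiffAt, iteratedDeriv_const_mul_field,
    iteratedDeriv_fun_sub (analyticAt_csc hx).contDiffAt hi.contDiffAt,
    iteratedDeriv_inv_sub, iteratedDeriv_inv_sub, Odd.neg_one_pow ⟨r - 1, by omega⟩,
    show 2 * r - 1 + 1 = 2 * r by omega, sub_zero, F]
  ring

/-! ### The integral of the regular part -/

theorem hasDerivAt_log_sinc_half {x : ℝ} (hx : Real.sin (x / 2) ≠ 0) :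
    HasDerivAt (fun x => Real.log (Real.sinc (x / 2)))
      (Real.cos (x / 2) / (2 * Real.sin (x / 2)) - x⁻¹) x := by
  have h0 : x ≠ 0 := by rintro rfl; simp at hx
  have hh : HasDerivAt (fun x : ℝ => x / 2) (1 / 2) x := (hasDerivAt_id x).div_const 2
  have h1 := hh.sin.log hx
  have h2 := hh.log (div_ne_zero h0 two_ne_zero)
  have h3 := h1.sub h2
  have e : (fun x => Real.log (Real.sinc (x / 2))) =ᶠ[𝓝 x]
      (fun x => Real.log (Real.sin (x / 2))) - fun x => Real.log (x / 2) := by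
    have c : ContinuousAt (fun x : ℝ => Real.sin (x / 2)) x := by fun_prop
    filter_upwards [c.eventually_ne hx] with y hy
    have hy0 : y / 2 ≠ 0 := by intro h; rw [h] at hy; simp at hy
    rw [Real.sinc_of_ne_zero hy0, Real.log_div hy hy0]
    rfl
  refine (h3.congr_of_eventuallyEq e).congr_deriv ?_
  field_simp

theorem sinc_pos {x : ℝ} (h1 : -Real.pi < x) (h2 : x < Real.pi) : 0 < Real.sinc x := by
  rcases lt_trichotomy x 0 with h | rfl | h
  · rw [Real.sinc_of_ne_zero h.ne]
    exact div_pos_of_neg_of_neg (Real.sin_neg_of_neg_of_neg_pi_lt h h1) h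
  · simp
  · rw [Real.sinc_of_ne_zero h.ne']
    exact div_pos (Real.sin_pos_of_pos_of_lt_pi h h2) h

theorem csc_eq_half {x : ℝ} (hs : Real.sin (x / 2) ≠ 0) (hc : Real.cos (x / 2) ≠ 0) :
    csc x = Real.cos (x / 2) / (2 * Real.sin (x / 2)) + Real.sin (x / 2) / (2 * Real.cos (x / 2)) := by
  have h : Real.sin x = 2 * Real.sin (x / 2) * Real.cos (x / 2) := by
    rw [← Real.sin_two_mul]; congr 1; ring
  rw [csc, h]
  field_simp
  rw [add_comm, Real.sin_sq_add_cos_sq]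

/-- An antiderivative of `csc` is `log |tan (x/2)|`. Writing `sinc (x/2)` for `sin (x/2)` absorbs
the pole at `0`. For `a > 1`, `|cos (x/2)|` is likewise replaced by `sinc ((x - π)/2)`, which stays
positive across `π`, so the antiderivative is continuous on the whole interval. -/
theorem integral_regularPart {a : ℝ} (ha0 : 0 < a) (ha2 : a < 2) (ha1 : a ≠ 1) :
    ∫ t in (0 : ℝ)..(a * Real.pi), regularPart (delta a) t
      = Real.log |Real.tan (Real.pi * a / 2)| + Real.log (2 / (Real.pi * a))
        + delta a * (Real.log (a * Real.pi - Real.pi) - Real.log Real.pi) := by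
  have hpi := Real.pi_pos
  have hL : 0 < a * Real.pi := by positivity
  have hi : IntervalIntegrable (regularPart (delta a)) MeasureTheory.volume 0 (a * Real.pi) := by
    apply ContinuousOn.intervalIntegrable
    rw [Set.uIcc_of_le hL.le]
    exact fun t ht => (analyticAt_regularPart ha2 ht).continuousAt.continuousWithinAt
  have hL2 : a * Real.pi / 2 < Real.pi := by nlinarith
  have hsin : 0 < Real.sin (a * Real.pi / 2) :=
    Real.sin_pos_of_pos_of_lt_pi (by linarith) hL2
  have e1 : Real.pi * a / 2 = a * Real.pi / 2 := by ring
  have hsinc : ∀ t ∈ Set.Icc 0 (a * Real.pi), 0 < Real.sinc (t / 2) := fun t ht =>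
    sinc_pos (by linarith [ht.1]) (by linarith [ht.2])
  have hcs : ContinuousOn (fun t => Real.log (Real.sinc (t / 2))) (Set.Icc 0 (a * Real.pi)) :=
    ContinuousOn.log (Continuous.continuousOn (Real.continuous_sinc.comp (by fun_prop)))
      fun t ht => (hsinc t ht).ne'
  have hval : Real.log (Real.sinc (a * Real.pi / 2))
      = Real.log (Real.sin (a * Real.pi / 2)) + Real.log (2 / (Real.pi * a)) := by
    rw [Real.sinc_of_ne_zero (by positivity), ← Real.log_mul hsin.ne' (by positivity)]
    congr 1
    field_simp
  rcases lt_or_gt_of_ne ha1 with ha | ha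
  · have hd : delta a = 0 := if_pos ha
    have hcos : ∀ t ∈ Set.Icc 0 (a * Real.pi), 0 < Real.cos (t / 2) := fun t ht =>
      Real.cos_pos_of_mem_Ioo ⟨by linarith [ht.1], by nlinarith [ht.2]⟩
    -- With an empty exceptional set, this form still asks for the derivative only on the open
    -- interval, which avoids the endpoint `0`.
    rw [MeasureTheory.integral_eq_of_hasDerivAt_off_countable
      (fun x => Real.log (Real.sinc (x / 2)) - Real.log (Real.cos (x / 2))) _
      Set.countable_empty _ _ hi]
    · have hc := hcos _ ⟨hL.le, le_rfl⟩
      rw [hd, hval, e1, Real.tan_eq_sin_div_cos, abs_of_pos (div_pos hsin hc),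
        Real.log_div hsin.ne' hc.ne']
      simp
      ring
    · rw [Set.uIcc_of_le hL.le]
      exact hcs.sub (ContinuousOn.log (by fun_prop) fun t ht => (hcos t ht).ne')
    · intro x hx
      rw [min_eq_left hL.le, max_eq_right hL.le, Set.sdiff_empty] at hx
      have hs : 0 < Real.sin (x / 2) :=
        Real.sin_pos_of_pos_of_lt_pi (by linarith [hx.1]) (by linarith [hx.2])
      have hc := hcos x ⟨hx.1.le, hx.2.le⟩
      have hh : HasDerivAt (fun x : ℝ => x / 2) (1 / 2) x := (hasDerivAt_id x).div_const 2
      refine ((hasDerivAt_log_sinc_half hs.ne').sub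
        (hh.cos.log hc.ne')).congr_deriv ?_
      rw [regularPart, hd, csc_eq_half hs.ne' hc.ne']
      ring
  · have hd : delta a = 1 := if_neg (not_lt.2 ha.le)
    have hsinc' : ∀ t ∈ Set.Icc 0 (a * Real.pi), 0 < Real.sinc ((t - Real.pi) / 2) := fun t ht =>
      sinc_pos (by linarith [ht.1]) (by linarith [ht.2])
    have hsh : ∀ t : ℝ, Real.sin ((t - Real.pi) / 2) = -Real.cos (t / 2) := fun t => by
      rw [sub_div, Real.sin_sub_pi_div_two]
    have hch : ∀ t : ℝ, Real.cos ((t - Real.pi) / 2) = Real.sin (t / 2) := fun t => by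
      rw [sub_div, Real.cos_sub_pi_div_two]
    -- Continuity at `π` suffices, so `π` is the one exceptional point.
    rw [MeasureTheory.integral_eq_of_hasDerivAt_off_countable
      (fun x => Real.log (Real.sinc (x / 2)) - Real.log (Real.sinc ((x - Real.pi) / 2))) _
      (Set.countable_singleton Real.pi) _ _ hi]
    · have hcneg : Real.cos (a * Real.pi / 2) < 0 :=
        Real.cos_neg_of_pi_div_two_lt_of_lt (by nlinarith) (by linarith)
      have hm : 0 < a * Real.pi - Real.pi := by nlinarith
      have v1 : Real.log (Real.sinc ((a * Real.pi - Real.pi) / 2))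
          = Real.log (-Real.cos (a * Real.pi / 2)) + Real.log 2
            - Real.log (a * Real.pi - Real.pi) := by
        rw [Real.sinc_of_ne_zero (by positivity), hsh, Real.log_div (by linarith) (by positivity),
          Real.log_div hm.ne' two_ne_zero]
        ring
      have v2 : Real.log (Real.sinc ((0 - Real.pi) / 2)) = Real.log 2 - Real.log Real.pi := by
        rw [show (0 - Real.pi) / 2 = -(Real.pi / 2) by ring, Real.sinc_neg,
          Real.sinc_of_ne_zero (by positivity), Real.sin_pi_div_two,
          Real.log_div one_ne_zero (by positivity), Real.log_div hpi.ne' two_ne_zero, Real.log_one]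
        ring
      rw [v1, v2, hd, hval, e1, Real.tan_eq_sin_div_cos, abs_div, abs_of_pos hsin,
        abs_of_neg hcneg, Real.log_div hsin.ne' (by linarith)]
      simp
      ring
    · rw [Set.uIcc_of_le hL.le]
      exact hcs.sub (ContinuousOn.log
        (Continuous.continuousOn (Real.continuous_sinc.comp (by fun_prop)))
        fun t ht => (hsinc' t ht).ne')
    · intro x hx
      rw [min_eq_left hL.le, max_eq_right hL.le] at hx
      obtain ⟨⟨hx0, hxL⟩, hxpi⟩ := hx
      have hxpi' : x - Real.pi ≠ 0 := sub_ne_zero.2 hxpi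
      have hs : 0 < Real.sin (x / 2) :=
        Real.sin_pos_of_pos_of_lt_pi (by linarith) (by linarith)
      have hs' : Real.sin ((x - Real.pi) / 2) ≠ 0 := by
        intro h
        have := (Real.sin_eq_zero_iff_of_lt_of_lt (by linarith) (by linarith)).1 h
        exact hxpi' (by linarith)
      have hc : Real.cos (x / 2) ≠ 0 := by
        rw [hsh] at hs'
        exact neg_ne_zero.1 hs'
      have h2 := (hasDerivAt_log_sinc_half hs').comp x ((hasDerivAt_id x).sub_const Real.pi)
      refine ((hasDerivAt_log_sinc_half hs.ne').sub h2).congr_deriv ?_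
      rw [regularPart, hd, csc_eq_half hs.ne' hc, hsh, hch]
      field_simp
      ring

/-! ### Assembling the expansions and bounding the error -/

/-- Pole removal applied to each sample, the first pole giving `H_{n-1} = H_n - 1/n`. The samples `l
= 0` and `l = n` are added to the regular sum and subtracted again, to match Euler–Maclaurin. -/
theorem S_eq {a : ℝ} (ha0 : 0 < a) (d : ℝ) {n : ℕ} (hn : 1 ≤ n) :
    S n 0 a = n / (a * Real.pi) * ((harmonic n : ℝ) - 1 / n)
      - d * (n / (a * Real.pi)) * (∑ l ∈ Finset.Ico 1 n, 1 / ((l : ℝ) - n / a))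
      + ((∑ l ∈ Finset.range (n + 1), regularPart d (a * Real.pi / n * l))
        - regularPart d 0 - regularPart d (a * Real.pi)) := by
  have hpi := Real.pi_pos
  have hn0 : (0 : ℝ) < n := by exact_mod_cast hn
  have hH : (harmonic n : ℝ) - 1 / n = ∑ l ∈ Finset.Ico 1 n, 1 / (l : ℝ) := by
    obtain ⟨m, rfl⟩ : ∃ m, n = m + 1 := ⟨n - 1, by omega⟩
    rw [harmonic_succ, harmonic_eq_sum_Icc]
    push_cast
    have : Finset.Icc 1 m = Finset.Ico 1 (m + 1) := rfl
    rw [this]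
    simp
  have hR : (∑ l ∈ Finset.range (n + 1), regularPart d (a * Real.pi / n * l))
        - regularPart d 0 - regularPart d (a * Real.pi)
      = ∑ l ∈ Finset.Ico 1 n, regularPart d (a * Real.pi / n * l) := by
    rw [Finset.sum_range_succ, div_mul_cancel₀ _ hn0.ne', Finset.range_eq_Ico,
      Finset.sum_eq_sum_Ico_succ_bot (by omega : 0 < n), Nat.cast_zero, mul_zero, zero_add]
    ring
  rw [hH, hR, Finset.mul_sum, Finset.mul_sum, ← Finset.sum_sub_distrib, ← Finset.sum_add_distrib, S]
  refine Finset.sum_congr rfl fun l hl => ?_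
  have e1 : 0 + a * Real.pi * l / n = a * Real.pi / n * l := by ring
  have e2 : (a * Real.pi / n * l)⁻¹ = n / (a * Real.pi) * (1 / l) := by
    rw [mul_inv, inv_div, one_div]
  have e3 : (a * Real.pi / n * l - Real.pi)⁻¹ = n / (a * Real.pi) * (1 / ((l : ℝ) - n / a)) := by
    rw [show a * Real.pi / n * l - Real.pi = a * Real.pi / n * (l - n / a) by field_simp,
      mul_inv, inv_div, one_div]
  rw [e1, regularPart, e2, e3]
  ring

/-- Matches the digamma term at `nq/L` with the Euler–Maclaurin boundary term of a pole at distance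
`q` from an endpoint. It is used for `q = L`, `L - π` and `π`, with `L = aπ`. -/
theorem scaled_stirling_term {L q : ℝ} (hL : L ≠ 0) (hq : q ≠ 0) {n : ℕ} (hn : 1 ≤ n) {r : ℕ}
    (hr : 1 ≤ r) (B : ℝ) :
    n / L * (B / (2 * r) / (n * q / L) ^ (2 * r))
      = B / (2 * r).factorial * ((L / n) ^ (2 * r - 1) * ((2 * r - 1).factorial / q ^ (2 * r))) := by
  obtain ⟨p, rfl⟩ : ∃ p, r = p + 1 := ⟨r - 1, by omega⟩
  have hn0 : (n : ℝ) ≠ 0 := by positivity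
  have hf : ((2 * p + 1).factorial : ℝ) ≠ 0 := by positivity
  rw [show 2 * (p + 1) - 1 = 2 * p + 1 by omega,
    show (2 * (p + 1)).factorial = (2 * p + 1 + 1) * (2 * p + 1).factorial from
      Nat.factorial_succ _, show 2 * (p + 1) = 2 * p + 1 + 1 by ring, div_pow, mul_pow, div_pow]
  push_cast
  field_simp
  ring

theorem sin_mul_pi_ne_zero {a : ℝ} (ha0 : 0 < a) (ha2 : a < 2) (ha1 : a ≠ 1) :
    Real.sin (a * Real.pi) ≠ 0 := by
  have hpi := Real.pi_pos
  intro h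
  have h1 : Real.sin (a * Real.pi - Real.pi) = 0 := by rw [Real.sin_sub_pi, h, neg_zero]
  have h2 := (Real.sin_eq_zero_iff_of_lt_of_lt (by nlinarith) (by nlinarith)).1 h1
  have h3 : (a - 1) * Real.pi = 0 := by linarith
  rcases mul_eq_zero.1 h3 with h4 | h4
  · exact ha1 (by linarith)
  · exact hpi.ne' h4

/-- The right side is what results when each piece of `S_eq` is replaced by its approximation. The
equality is exact, so the error of the expansion is a combination of the three individual errors. -/
theorem logExpansion_eq {a : ℝ} (ha0 : 0 < a) (ha2 : a < 2) (ha1 : a ≠ 1) (N : ℕ) {n : ℕ}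
    (hn : 1 ≤ n) :
    logExpansion a N n
      = n / (a * Real.pi) * (Real.eulerMascheroniConstant - stirlingPart N n)
        + delta a * (n / (a * Real.pi)) * (Real.pi * Real.cot (Real.pi * (n / a))
          + (stirlingPart N (n - n / a) - stirlingPart N (n / a)))
        + n / (a * Real.pi) * (∫ t in (0 : ℝ)..(a * Real.pi), regularPart (delta a) t)
        - (regularPart (delta a) 0 + regularPart (delta a) (a * Real.pi)) / 2
        + ∑ r ∈ Finset.Icc 1 (N - 1), (bernoulli (2 * r) : ℝ) / (2 * r).factorial *
          ((a * Real.pi / n) ^ (2 * r - 1) *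
            (iteratedDeriv (2 * r - 1) (regularPart (delta a)) (a * Real.pi)
              - iteratedDeriv (2 * r - 1) (regularPart (delta a)) 0)) := by
  have hpi := Real.pi_pos
  have hn0 : (0 : ℝ) < n := by exact_mod_cast hn
  have hsin := sin_mul_pi_ne_zero ha0 ha2 ha1
  have hL : 0 < a * Real.pi := by positivity
  have hq : a * Real.pi - Real.pi ≠ 0 := by
    rw [show a * Real.pi - Real.pi = (a - 1) * Real.pi by ring]
    exact mul_ne_zero (sub_ne_zero.2 ha1) hpi.ne'
  have x1 : (n : ℝ) / a = n * Real.pi / (a * Real.pi) := by field_simp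
  have x2 : (n : ℝ) - n / a = n * (a * Real.pi - Real.pi) / (a * Real.pi) := by field_simp
  have x3 : (n : ℝ) = n * (a * Real.pi) / (a * Real.pi) := by field_simp
  have hsum : ∑ r ∈ Finset.Icc 1 (N - 1),
        (a * Real.pi) ^ (2 * r - 1) * (bernoulli (2 * r) : ℝ)
          / ((n : ℝ) ^ (2 * r - 1) * ((2 * r).factorial : ℝ)) * bracket a r
      = -(n / (a * Real.pi)) * (∑ r ∈ Finset.Icc 1 (N - 1),
          (bernoulli (2 * r) : ℝ) / (2 * r) / (n : ℝ) ^ (2 * r))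
        + delta a * ((n / (a * Real.pi)) * (∑ r ∈ Finset.Icc 1 (N - 1),
          (bernoulli (2 * r) : ℝ) / (2 * r) / ((n : ℝ) - n / a) ^ (2 * r)))
        - delta a * ((n / (a * Real.pi)) * (∑ r ∈ Finset.Icc 1 (N - 1),
          (bernoulli (2 * r) : ℝ) / (2 * r) / ((n : ℝ) / a) ^ (2 * r)))
        + ∑ r ∈ Finset.Icc 1 (N - 1), (bernoulli (2 * r) : ℝ) / (2 * r).factorial *
          ((a * Real.pi / n) ^ (2 * r - 1) *
            (iteratedDeriv (2 * r - 1) (regularPart (delta a)) (a * Real.pi)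
              - iteratedDeriv (2 * r - 1) (regularPart (delta a)) 0)) := by
    simp only [Finset.mul_sum]
    rw [← Finset.sum_add_distrib, ← Finset.sum_sub_distrib, ← Finset.sum_add_distrib]
    refine Finset.sum_congr rfl fun r hr => ?_
    have hr1 := (Finset.mem_Icc.1 hr).1
    have t1 := scaled_stirling_term hL.ne' hL.ne' hn hr1 (bernoulli (2 * r) : ℝ)
    have t2 := scaled_stirling_term hL.ne' hq hn hr1 (bernoulli (2 * r) : ℝ)
    have t3 := scaled_stirling_term hL.ne' hpi.ne' hn hr1 (bernoulli (2 * r) : ℝ)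
    rw [← x3] at t1
    rw [← x2] at t2
    rw [← x1] at t3
    rw [neg_mul, t1, t2, t3, iteratedDeriv_regularPart_zero _ r hr1,
      iteratedDeriv_regularPart _ hsin r hr1, bracket, div_pow]
    rw [mul_comm ((n : ℝ) ^ (2 * r - 1)), mul_comm ((a * Real.pi) ^ (2 * r - 1)), mul_div_mul_comm]
    ring
  -- Both differences are `± log (a - 1)`. No case split is needed, because `Real.log` ignores
  -- signs.
  have hlog : delta a * (Real.log (n / a) - Real.log (n - n / a)
      + (Real.log (a * Real.pi - Real.pi) - Real.log Real.pi)) = 0 := by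
    rw [x2, Real.log_div (mul_ne_zero hn0.ne' hq) hL.ne', Real.log_mul hn0.ne' hq,
      Real.log_div hn0.ne' ha0.ne', Real.log_mul ha0.ne' hpi.ne']
    ring
  have hlog2 : Real.log (2 * n / (Real.pi * a)) = Real.log n + Real.log (2 / (Real.pi * a)) := by
    rw [← Real.log_mul hn0.ne' (by positivity)]
    congr 1
    ring
  have g0 : regularPart (delta a) 0 = -(delta a / Real.pi) := by
    simp [regularPart, csc, inv_neg, div_eq_mul_inv]
  have gL : regularPart (delta a) (a * Real.pi)
      = csc (a * Real.pi) - 1 / (a * Real.pi) + delta a * (1 / (a * Real.pi - Real.pi)) := by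
    simp [regularPart]
  have h1 : n / (a * Real.pi) * (1 / (2 * (n : ℝ))) = 1 / (a * Real.pi) / 2 := by field_simp
  have h2 : n / (a * Real.pi) * (1 / (2 * ((n : ℝ) - n / a)))
      = 1 / (a * Real.pi - Real.pi) / 2 := by rw [x2]; field_simp
  have h3 : n / (a * Real.pi) * (1 / (2 * ((n : ℝ) / a))) = 1 / Real.pi / 2 := by field_simp
  have h4 : n * delta a / a * Real.cot (Real.pi * n / a)
      = delta a * (n / (a * Real.pi)) * (Real.pi * Real.cot (Real.pi * (n / a))) := by
    rw [mul_div_assoc Real.pi]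
    field_simp
  rw [logExpansion, hsum, h4, hlog2, integral_regularPart ha0 ha2 ha1, g0, gL, stirlingPart,
    stirlingPart, stirlingPart]
  linear_combination (h1 - delta a * h2 + delta a * h3) - (n / (a * Real.pi)) * hlog

/-- The two expansions differ exactly by the error in expanding `H_n`, so the harmonic form is free
of that error. -/
theorem harmonicExpansion_eq {a : ℝ} (ha0 : 0 < a) (N : ℕ) {n : ℕ} (hn : 1 ≤ n) :
    harmonicExpansion a N n = logExpansion a N n - n / (a * Real.pi) *
      (Real.eulerMascheroniConstant - (harmonic n : ℝ) + 1 / n - stirlingPart N n) := by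
  have hpi := Real.pi_pos
  have hn0 : (0 : ℝ) < n := by exact_mod_cast hn
  have hlog2 : Real.log (2 * n / (Real.pi * a)) = Real.log n + Real.log (2 / (Real.pi * a)) := by
    rw [← Real.log_mul hn0.ne' (by positivity)]
    congr 1
    ring
  have h1 : n / (a * Real.pi) * (1 / (2 * (n : ℝ))) = 1 / (2 * Real.pi * a) := by field_simp
  have h2 : n / (a * Real.pi) * (1 / (n : ℝ)) = 2 * (1 / (2 * Real.pi * a)) := by field_simp
  have s1 : 1 / 2 * ∑ r ∈ Finset.Icc 1 (N - 1), (bernoulli (2 * r) : ℝ) / (r * (n : ℝ) ^ (2 * r))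
      = ∑ r ∈ Finset.Icc 1 (N - 1), (bernoulli (2 * r) : ℝ) / (2 * r) / (n : ℝ) ^ (2 * r) := by
    rw [Finset.mul_sum]
    refine Finset.sum_congr rfl fun r _ => ?_
    rw [div_div, mul_assoc, div_mul_div_comm, one_mul]
  have s2 : ∑ r ∈ Finset.Icc 1 (N - 1),
        (a * Real.pi) ^ (2 * r - 1) * (bernoulli (2 * r) : ℝ)
          / ((n : ℝ) ^ (2 * r - 1) * ((2 * r).factorial : ℝ)) * bracket a r
      = n / (a * Real.pi) * ∑ r ∈ Finset.Icc 1 (N - 1),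
          (a * Real.pi) ^ (2 * r) * (bernoulli (2 * r) : ℝ)
            / ((n : ℝ) ^ (2 * r) * ((2 * r).factorial : ℝ)) * bracket a r := by
    rw [Finset.mul_sum]
    refine Finset.sum_congr rfl fun r hr => ?_
    have hr1 := (Finset.mem_Icc.1 hr).1
    obtain ⟨p, rfl⟩ : ∃ p, r = p + 1 := ⟨r - 1, by omega⟩
    rw [show 2 * (p + 1) - 1 = 2 * p + 1 by omega, show 2 * (p + 1) = 2 * p + 1 + 1 by ring,
      pow_succ (n : ℝ) (2 * p + 1), pow_succ (a * Real.pi) (2 * p + 1)]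
    field_simp
  rw [harmonicExpansion, logExpansion, s1, s2, hlog2, stirlingPart]
  linear_combination (-1 : ℝ) * h1 + h2

/-- The `O`-terms are controlled by `n ^ (1 - 2 N)`. -/
theorem error_bounds {a : ℝ} (ha0 : 0 < a) (ha2 : a < 2) (ha1 : a ≠ 1) (N : ℕ) (hN : 1 ≤ N) :
    ∃ C : ℝ, ∀ n : ℕ, 1 ≤ n → (1 < a → ∀ k : ℤ, (n : ℝ) ≠ a * k) →
      |S n 0 a - harmonicExpansion a N n| ≤ C / (n : ℝ) ^ (2 * N - 1) ∧
      |S n 0 a - logExpansion a N n| ≤ C / (n : ℝ) ^ (2 * N - 1) := by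
  have hpi := Real.pi_pos
  have hL : 0 < a * Real.pi := by positivity
  obtain ⟨C1, hC1, h1⟩ := harmonic_bound N hN
  obtain ⟨C2, hC2, h2⟩ := poleSum_bound N hN
  obtain ⟨C3, hC3, h3⟩ := euler_maclaurin_samples hL
    (fun t ht => analyticAt_regularPart ha2 ht) N hN
  set A1 := C1 / (a * Real.pi) with hA1
  -- The pole sum has `x = n/a` and `n - x = n(1 - 1/a)`, so `n^(2N)` factors out of both error
  -- terms, and the prefactor `n/(aπ)` returns one power of `n`.
  set A2 := (C2 / (1 - 1 / a) ^ (2 * N) + C2 / (1 / a) ^ (2 * N)) / (a * Real.pi) with hA2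
  have hA1n : 0 ≤ A1 := by positivity
  refine ⟨A1 + A2 + C3, fun n hn hna => ?_⟩
  have hn0 : (0 : ℝ) < n := by exact_mod_cast hn
  have hpow : (n : ℝ) ^ (2 * N) = n ^ (2 * N - 1) * n := by
    rw [← pow_succ]; congr 1; omega
  have hA2n : 0 ≤ A2 := by
    -- For `a < 1` the base `1 - 1/a` is negative; the even exponent gives the sign.
    have e : ∀ x : ℝ, 0 ≤ x ^ (2 * N) := fun x => Even.pow_nonneg ⟨N, by ring⟩ x
    exact div_nonneg (add_nonneg (div_nonneg hC2 (e _)) (div_nonneg hC2 (e _))) hL.le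
  set e1 := Real.eulerMascheroniConstant - (harmonic n : ℝ) + 1 / n - stirlingPart N n with he1
  set e2 := (∑ l ∈ Finset.Ico 1 n, 1 / ((l : ℝ) - n / a)) + Real.pi * Real.cot (Real.pi * (n / a))
      + (stirlingPart N (n - n / a) - stirlingPart N (n / a)) with he2
  have b1 : |n / (a * Real.pi) * e1| ≤ A1 / (n : ℝ) ^ (2 * N - 1) := by
    rw [abs_mul, abs_of_pos (by positivity)]
    refine (mul_le_mul_of_nonneg_left (h1 n hn) (by positivity)).trans (le_of_eq ?_)
    rw [hpow, hA1]
    field_simp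
  have b2 : |delta a * (n / (a * Real.pi)) * e2| ≤ A2 / (n : ℝ) ^ (2 * N - 1) := by
    rcases lt_or_gt_of_ne ha1 with ha | ha
    · rw [delta, if_pos ha, zero_mul, zero_mul, abs_zero]
      positivity
    · rw [delta, if_neg (not_lt.2 ha.le), one_mul, abs_mul, abs_of_pos (by positivity)]
      have hx : ∀ k : ℤ, (n : ℝ) / a ≠ k := fun k hk => by
        apply hna ha k
        rw [← hk]
        field_simp
      refine (mul_le_mul_of_nonneg_left (h2 n (n / a) (by positivity) (div_lt_self hn0 ha) hx)
        (by positivity)).trans (le_of_eq ?_)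
      rw [show (n : ℝ) - n / a = n * (1 - 1 / a) by ring, show (n : ℝ) / a = n * (1 / a) by ring,
        mul_pow, mul_pow, hpow, hA2]
      have hp1 : (1 - 1 / a) ^ (2 * N) ≠ 0 := by
        apply pow_ne_zero
        have : 1 / a < 1 := (div_lt_one ha0).2 ha
        linarith
      have hp2 : (1 / a) ^ (2 * N) ≠ 0 := by positivity
      generalize (1 - 1 / a) ^ (2 * N) = u at *
      generalize (1 / a) ^ (2 * N) = v at *
      field_simp
  have b3 := h3 n hn
  set e3 := (∑ l ∈ Finset.range (n + 1), regularPart (delta a) (a * Real.pi / n * l))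
      - (n / (a * Real.pi)) * (∫ t in (0 : ℝ)..(a * Real.pi), regularPart (delta a) t)
      - (regularPart (delta a) 0 + regularPart (delta a) (a * Real.pi)) / 2
      - ∑ r ∈ Finset.Icc 1 (N - 1), (bernoulli (2 * r) : ℝ) / (2 * r).factorial *
          ((a * Real.pi / n) ^ (2 * r - 1) *
            (iteratedDeriv (2 * r - 1) (regularPart (delta a)) (a * Real.pi)
              - iteratedDeriv (2 * r - 1) (regularPart (delta a)) 0)) with he3
  have hlogE : S n 0 a - logExpansion a N n
      = -(n / (a * Real.pi) * e1) - delta a * (n / (a * Real.pi)) * e2 + e3 := by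
    rw [S_eq ha0 (delta a) hn, logExpansion_eq ha0 ha2 ha1 N hn, he1, he2, he3]
    ring
  have hharE : S n 0 a - harmonicExpansion a N n
      = -(delta a * (n / (a * Real.pi)) * e2) + e3 := by
    rw [harmonicExpansion_eq ha0 N hn]
    linear_combination hlogE
  have hp : 0 ≤ A1 / (n : ℝ) ^ (2 * N - 1) := by positivity
  rw [add_div, add_div, hharE, hlogE]
  rw [abs_le] at b1 b2 b3
  constructor <;> rw [abs_le] <;> constructor <;> linarith

end CosecantSum

theorem mainTheorem4 (a : ℝ) (ha0 : 0 < a) (ha2 : a < 2) (ha1 : a ≠ 1) (N : ℕ) (hN : 2 ≤ N) :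
    ((fun n : ℕ => CosecantSum.S n 0 a - CosecantSum.harmonicExpansion a N n)
        =O[atTop ⊓ 𝓟 {n : ℕ | 1 < a → ∀ k : ℤ, (n : ℝ) ≠ a * k}]
      fun n : ℕ => (n : ℝ) ^ (1 - 2 * (N : ℤ))) ∧
    ((fun n : ℕ => CosecantSum.S n 0 a - CosecantSum.logExpansion a N n)
        =O[atTop ⊓ 𝓟 {n : ℕ | 1 < a → ∀ k : ℤ, (n : ℝ) ≠ a * k}]
      fun n : ℕ => (n : ℝ) ^ (1 - 2 * (N : ℤ))) := by
  obtain ⟨C, hC⟩ := CosecantSum.error_bounds ha0 ha2 ha1 N (by omega)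
  have hpow : ∀ n : ℕ, C * ‖(n : ℝ) ^ (1 - 2 * (N : ℤ))‖ = C / (n : ℝ) ^ (2 * N - 1) := by
    intro n
    have e : (1 - 2 * (N : ℤ)) = -((2 * N - 1 : ℕ) : ℤ) := by omega
    rw [e, zpow_neg, zpow_natCast, Real.norm_of_nonneg (by positivity), div_eq_mul_inv]
  constructor
  · refine IsBigO.of_bound C (eventually_inf_principal.2 ?_)
    filter_upwards [eventually_ge_atTop 1] with n hn hmem
    rw [hpow]
    exact (hC n hn hmem).1
  · refine IsBigO.of_bound C (eventually_inf_principal.2 ?_)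
    filter_upwards [eventually_ge_atTop 1] with n hn hmem
    rw [hpow]
    exact (hC n hn hmem).2
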